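/- Let $X$ be a locally small (possibly large) category which is finitely pre-cocomplete, i.e. for every finite diagram $D$ in $X$ there is a set of cocones under $D$ such that every cocone under $D$ factors, not necessarily uniquely, through one of them. Let $\mathsf{P}(X)$ be the category of small copresheaves on $X$, i.e. the full subcategory of $\mathbf{Set}^X$ on the functors that are small colimits of corepresentables, and let $\mathrm{Int}$ be a comonad on $\mathsf{P}(X)$ whose underlying functor preserves finite limits; thus $\mathcal{X}=(X,\mathrm{Int})$ is a generalized ionad. Let $\mathbb{O}(\mathcal{X})$ be the category of $\mathrm{Int}$-coalgebras. For a Grothendieck topos $\mathcal{G}$, a geometric surjection $f:\mathsf{P}(X)\twoheadrightarrow\mathcal{G}$ is an adjunction $f^*\dashv f_*$ with $f^*:\mathcal{G}\to\mathsf{P}(X)$ faithful and preserving finite limits. A functor from a small category $B$ is called flat if its left Kan extension along the Yoneda embedding $B\to\mathbf{Set}^{B^{\mathrm{op}}}$ exists and preserves finite limits. A flat functor $e:B\to\mathsf{P}(X)$ generates $\mathcal{X}$ if its density comonad $\mathrm{lan}_e e$ exists and $\mathrm{Int}\cong\mathrm{lan}_e e$ as comonads. Then the following are equivalent (and $\mathcal{X}$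 is called bounded if they hold): 1. $\mathbb{O}(\mathcal{X})$ is a Grothendieck topos, i.e. equivalent to the category of sheaves of sets on a small site. 2. There exist a Grothendieck topos $\mathcal{G}$ and a geometric surjection $f:\mathsf{P}(X)\twoheadrightarrow\mathcal{G}$ such that $\mathrm{Int}\cong f^*f_*$ as comonads. 3. There exist a Grothendieck topos $\mathcal{G}$, a geometric surjection $f:\mathsf{P}(X)\twoheadrightarrow\mathcal{G}$, a small category $B$ and a flat functor $e:B\to\mathcal{G}$ such that $f^*e:B\to\mathsf{P}(X)$ is flat and generates $\mathcal{X}$. -/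

import Mathlib

open CategoryTheory CategoryTheory.Limits

universe u v₁ v₂ u₁ u₂ w

namespace GenIonad

/-- A diagram `D` has a pre-colimit: there is a (small) set of cocones under `D` such that every
cocone under `D` factors, not necessarily uniquely, through some member of the set. -/
def HasPreColimit {J : Type u₁} [Category.{v₁} J] {X : Type w} [Category.{u} X] (D : J ⥤ X) :
    Prop :=
  ∃ (I : Type u) (c : I → Cocone D), ∀ s : Cocone D, ∃ i : I, Nonempty (c i ⟶ s)

/-- `X` is finitely pre-cocomplete: every finite diagram in `X` has a pre-colimit. -/
def FinitelyPreCocomplete (X : Type w) [Category.{u} X] : Prop :=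
  ∀ (J : Type) [SmallCategory J] [FinCategory J] (D : J ⥤ X), HasPreColimit D

/-- A copresheaf `F : X ⥤ Type u` is small if it is a colimit, in the category of all copresheaves,
of a small diagram of corepresentable copresheaves. -/
def isSmallCopresheaf (X : Type w) [Category.{u} X] : ObjectProperty (X ⥤ Type u) := fun F =>
  ∃ (J : Type u) (_ : SmallCategory J) (D : J ⥤ X ⥤ Type u) (c : Cocone D),
    (∀ j, (D.obj j).IsCorepresentable) ∧ Nonempty (IsColimit c) ∧ Nonempty (c.pt ≅ F)

/-- The category of small copresheaves on the locally small category `X`, as a full subcategory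
of `X ⥤ Type u`. -/
abbrev SmallCopresheaf (X : Type w) [Category.{u} X] :=
  (isSmallCopresheaf X).FullSubcategory

/-- A Grothendieck topos: a category equivalent to the category of sheaves of sets on a small
site. -/
def IsGrothendieckTopos (E : Type u₁) [Category.{v₁} E] : Prop :=
  ∃ (C : Type u) (_ : SmallCategory C) (J : GrothendieckTopology C),
    Nonempty (E ≌ Sheaf J (Type u))

/-- A geometric morphism `E ⟶ F`: an adjunction whose left adjoint `inverseImage : F ⥤ E` preserves
finite limits. -/
structure GeometricMorphism (E : Type u₁) [Category.{v₁} E] (F : Type u₂) [Category.{v₂} F] where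
  inverseImage : F ⥤ E
  directImage : E ⥤ F
  adj : inverseImage ⊣ directImage
  lex : PreservesFiniteLimits inverseImage

/-- A geometric morphism is a surjection if its inverse image functor is faithful. -/
def GeometricMorphism.IsSurjection {E : Type u₁} [Category.{v₁} E] {F : Type u₂} [Category.{v₂} F]
    (f : GeometricMorphism E F) : Prop :=
  f.inverseImage.Faithful

/-- A functor `e` from a small category `B` to `E` is flat if its left Kan extension along the
Yoneda embedding exists and preserves finite limits. -/
def IsFlat {B : Type u} [SmallCategory B] {E : Type u₁} [Category.{v₁} E] (e : B ⥤ E) : Prop :=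
  ∃ (L : (Bᵒᵖ ⥤ Type u) ⥤ E) (α : e ⟶ yoneda ⋙ L),
    L.IsLeftKanExtension α ∧ PreservesFiniteLimits L

section DensityComonad

variable {B : Type u₁} [Category.{v₁} B] {E : Type u₂} [Category.{v₂} E]
  (e : B ⥤ E) [e.HasLeftKanExtension e]

/-- The counit of the density comonad, i.e. the transformation `lan_e e ⟶ 𝟭` corresponding to the
identity of `e`. -/
noncomputable def densityCounit : e.leftKanExtension e ⟶ 𝟭 E :=
  (e.leftKanExtension e).descOfIsLeftKanExtension (e.leftKanExtensionUnit e) (𝟭 E)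
    e.rightUnitor.inv

/-- The comultiplication of the density comonad, i.e. the transformation
`lan_e e ⟶ lan_e e ⋙ lan_e e` corresponding to the composite
`e ⟶ e ⋙ lan_e e ⟶ e ⋙ lan_e e ⋙ lan_e e` of two copies of the universal transformation. -/
noncomputable def densityComult :
    e.leftKanExtension e ⟶ e.leftKanExtension e ⋙ e.leftKanExtension e :=
  (e.leftKanExtension e).descOfIsLeftKanExtension (e.leftKanExtensionUnit e)
    (e.leftKanExtension e ⋙ e.leftKanExtension e)
    (e.leftKanExtensionUnit e ≫
      Functor.whiskerRight (e.leftKanExtensionUnit e) (e.leftKanExtension e) ≫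
      (Functor.associator _ _ _).hom)

@[simp]
lemma densityCounit_fac (b : B) :
    (e.leftKanExtensionUnit e).app b ≫ (densityCounit e).app (e.obj b) = 𝟙 (e.obj b) := by
  have h := (e.leftKanExtension e).descOfIsLeftKanExtension_fac_app
    (e.leftKanExtensionUnit e) (𝟭 E) e.rightUnitor.inv b
  exact h

@[simp]
lemma densityComult_fac (b : B) :
    (e.leftKanExtensionUnit e).app b ≫ (densityComult e).app (e.obj b) =
      (e.leftKanExtensionUnit e).app b ≫
        (e.leftKanExtension e).map ((e.leftKanExtensionUnit e).app b) := by
  have h := (e.leftKanExtension e).descOfIsLeftKanExtension_fac_app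
    (e.leftKanExtensionUnit e) (e.leftKanExtension e ⋙ e.leftKanExtension e)
    (e.leftKanExtensionUnit e ≫
      Functor.whiskerRight (e.leftKanExtensionUnit e) (e.leftKanExtension e) ≫
      (Functor.associator _ _ _).hom) b
  exact h.trans (by simp)

lemma density_hom_ext {G : E ⥤ E} (γ₁ γ₂ : e.leftKanExtension e ⟶ G)
    (h : ∀ b : B, (e.leftKanExtensionUnit e).app b ≫ γ₁.app (e.obj b) =
      (e.leftKanExtensionUnit e).app b ≫ γ₂.app (e.obj b)) : γ₁ = γ₂ :=
  Functor.hom_ext_of_isLeftKanExtension _ (e.leftKanExtensionUnit e) _ _ (by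
    ext b
    exact h b)

/-- The density comonad `lan_e e` of a functor `e`: the left Kan extension of `e` along itself. -/
noncomputable def densityComonad : Comonad E where
  toFunctor := e.leftKanExtension e
  ε := densityCounit e
  δ := densityComult e
  coassoc Y := by
    have h : densityComult e ≫ Functor.whiskerLeft _ (densityComult e) =
        densityComult e ≫ Functor.whiskerRight (densityComult e) (e.leftKanExtension e) ≫
          (Functor.associator _ _ _).hom := by
      apply density_hom_ext
      intro b
      have n := (densityComult e).naturality ((e.leftKanExtensionUnit e).app b)
      have k := densityComult_fac e b
      simp only [Functor.comp_map, Functor.comp_obj] at n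
      simp only [NatTrans.comp_app, Functor.whiskerLeft_app, Functor.whiskerRight_app,
        Functor.associator_hom_app, Category.comp_id, reassoc_of% k]
      rw [← (e.leftKanExtension e).map_comp, k, n, reassoc_of% k, Functor.map_comp]
    have h' := congrArg (fun t => t.app Y) h
    simpa using h'.symm
  left_counit Y := by
    have h : densityComult e ≫ Functor.whiskerLeft _ (densityCounit e) =
        𝟙 (e.leftKanExtension e) := by
      apply density_hom_ext
      intro b
      have n := (densityCounit e).naturality ((e.leftKanExtensionUnit e).app b)
      have k := densityComult_fac e b
      have l := densityCounit_fac e b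
      simp only [Functor.id_map, Functor.comp_obj] at n
      simp only [NatTrans.comp_app, Functor.whiskerLeft_app, NatTrans.id_app, reassoc_of% k]
      rw [n, reassoc_of% l]
      exact (Category.comp_id _).symm
    have h' := congrArg (fun t => t.app Y) h
    simpa using h'
  right_counit Y := by
    have h : densityComult e ≫ Functor.whiskerRight (densityCounit e) (e.leftKanExtension e) ≫
        (Functor.leftUnitor _).hom = 𝟙 (e.leftKanExtension e) := by
      apply density_hom_ext
      intro b
      have k := densityComult_fac e b
      have l := densityCounit_fac e b
      simp only [NatTrans.comp_app, Functor.whiskerRight_app, Functor.leftUnitor_hom_app,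
        NatTrans.id_app, reassoc_of% k]
      erw [Category.comp_id]
      rw [← (e.leftKanExtension e).map_comp, l, CategoryTheory.Functor.map_id]
    have h' := congrArg (fun t => t.app Y) h
    simpa using h'

end DensityComonad

end GenIonad

open GenIonad

/-- A generalized ionad on the locally small, possibly large category `X`: the category `X` is
finitely pre-cocomplete, and `interior` is a finite limit preserving comonad on the category of
small copresheaves on `X`. -/
structure GeneralizedIonad (X : Type w) [Category.{u} X] where
  preCocomplete : FinitelyPreCocomplete X
  interior : Comonad (SmallCopresheaf X)
  lex : PreservesFiniteLimits interior.toFunctor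

namespace GeneralizedIonad

variable {X : Type w} [Category.{u} X]

/-- The category of opens of an ionad: the category of coalgebras of its interior comonad. -/
abbrev Opens (𝒳 : GeneralizedIonad X) :=
  𝒳.interior.Coalgebra

/-- A functor `e : B ⥤ SmallCopresheaf X` on a small category `B` generates the ionad: it is flat,
and the interior comonad is isomorphic, as a comonad, to the density comonad of `e`. -/
def IsGeneratedBy (𝒳 : GeneralizedIonad X) {B : Type u} [SmallCategory B]
    (e : B ⥤ SmallCopresheaf X) : Prop :=
  IsFlat e ∧ ∃ _ : e.HasLeftKanExtension e, Nonempty (𝒳.interior ≅ densityComonad e)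

end GeneralizedIonad

-- Conditions 1 and 2 are matched by comonadicity. The forgetful functor from coalgebras of a lex
-- comonad is lex, faithful and left adjoint to the cofree functor, so it is the inverse image of a
-- surjection. Conversely, a lex conservative left adjoint out of a category with equalizers is
-- comonadic.
--
-- From 2 to 3, present the topos by a site `(C, J)`. The Yoneda embedding is dense, so a left
-- adjoint out of presheaves on `C` is the Kan extension of its restriction to `C`, and its comonad
-- is the density comonad of that restriction. Sheaves are reflective, so presheaves and sheaves
-- induce the same comonad (`exists_toComonad_iso_densityComonad`, `compToComonadIso`).
--
-- From 3 to 2, a generating flat functor on `B` extends to a lex functor `L` on presheaves, which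
-- is a left adjoint because small copresheaves are cocomplete and locally small. If `N` is its
-- right adjoint, `exists_surjection_of_adjunction` factors `L ⊣ N` through sheaves for the finest
-- topology making every `N Y` a sheaf. Maps inverted by `L` are locally bijective there, so `L` is
-- conservative on sheaves.
--
-- Pre-cocompleteness gives finite limits of small copresheaves. Any small set of objects lies in a
-- small full subcategory whose slices over the objects of `X` are filtered; Kan extension from it
-- is then lex, so a finite limit of copresheaves extended from it is again extended from it.

universe v₃ u₃

namespace GenIonad

/-! ### Comparison of comonads and of their coalgebras -/

section ComonadIso

variable {C : Type u₁} [Category.{v₁} C] {D : Type u₂} [Category.{v₂} D]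
  {E : Type u₃} [Category.{v₃} E]

/-- A comonad whose underlying functor is a left Kan extension of `e` along itself, compatibly with
the counit and comultiplication, is the density comonad of `e`. -/
noncomputable def densityComonadIso (e : C ⥤ E) [e.HasLeftKanExtension e] (T : Comonad E)
    (η : e ⟶ e ⋙ T.toFunctor) [T.toFunctor.IsLeftKanExtension η]
    (hε : ∀ b, η.app b ≫ T.ε.app (e.obj b) = 𝟙 _)
    (hδ : ∀ b, η.app b ≫ T.δ.app (e.obj b) = η.app b ≫ T.map (η.app b)) :
    densityComonad e ≅ T :=
  let φ := Functor.leftKanExtensionUnique (e.leftKanExtension e) (e.leftKanExtensionUnit e)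
    T.toFunctor η
  have hφ : ∀ b, (e.leftKanExtensionUnit e).app b ≫ φ.hom.app (e.obj b) = η.app b := fun b => by
    simp [φ]
  ComonadIso.mk φ
    (fun X => by
      have h : φ.hom ≫ T.ε = densityCounit e := by
        apply density_hom_ext
        intro b
        simp [reassoc_of% hφ, hε]
      exact congrArg (fun t => t.app X) h)
    (fun X => by
      have h : φ.hom ≫ T.δ = densityComult e ≫ Functor.whiskerLeft _ φ.hom ≫
          Functor.whiskerRight φ.hom T.toFunctor := by
        apply density_hom_ext
        intro b
        have k := densityComult_fac e b
        have n := φ.hom.naturality ((e.leftKanExtensionUnit e).app b)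
        simp only [NatTrans.comp_app, Functor.whiskerLeft_app, Functor.whiskerRight_app,
          reassoc_of% hφ, hδ, reassoc_of% k]
        rw [reassoc_of% n, ← Functor.map_comp, hφ, reassoc_of% hφ]
      exact congrArg (fun t => t.app X) h)

/-- Composing an adjunction with a reflection on the side of the source of the left adjoint does
not change the induced comonad. -/
noncomputable def compToComonadIso {L₁ : C ⥤ D} {R₁ : D ⥤ C} (adj₁ : L₁ ⊣ R₁) [IsIso adj₁.counit]
    {L₂ : D ⥤ E} {R₂ : E ⥤ D} (adj₂ : L₂ ⊣ R₂) :
    (adj₁.comp adj₂).toComonad ≅ adj₂.toComonad :=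
  ComonadIso.mk (Functor.isoWhiskerLeft R₂ (Functor.isoWhiskerRight (asIso adj₁.counit) L₂))
    (fun X => by
      change L₂.map (adj₁.counit.app (R₂.obj X)) ≫ adj₂.counit.app X =
        (adj₁.comp adj₂).counit.app X
      simp)
    (fun X => by
      change L₂.map (adj₁.counit.app (R₂.obj X)) ≫ L₂.map (adj₂.unit.app (R₂.obj X)) =
        L₂.map (L₁.map ((adj₁.comp adj₂).unit.app (R₁.obj (R₂.obj X)))) ≫
          L₂.map (adj₁.counit.app (R₂.obj (L₂.obj (L₁.obj (R₁.obj (R₂.obj X)))))) ≫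
            L₂.map (R₂.map (L₂.map (adj₁.counit.app (R₂.obj X))))
      have h : L₁.map ((adj₁.comp adj₂).unit.app (R₁.obj (R₂.obj X))) ≫
          adj₁.counit.app (R₂.obj (L₂.obj (L₁.obj (R₁.obj (R₂.obj X))))) =
            adj₂.unit.app (L₁.obj (R₁.obj (R₂.obj X))) := by
        simp
      have n := adj₂.unit.naturality (adj₁.counit.app (R₂.obj X))
      rw [← L₂.map_comp, ← L₂.map_comp, ← L₂.map_comp, reassoc_of% h]
      exact congrArg L₂.map n)

/-- The functor between categories of coalgebras induced by a morphism of comonads. -/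
@[simps]
def coalgebraFunctorOfComonadHom {G₁ G₂ : Comonad C} (h : G₁ ⟶ G₂) :
    G₁.Coalgebra ⥤ G₂.Coalgebra where
  obj A :=
    { A := A.A
      a := A.a ≫ h.app A.A
      counit := by simp [A.counit]
      coassoc := by simp [reassoc_of% A.coassoc] }
  map {A B} f :=
    { f := f.f
      h := by
        change (A.a ≫ h.app A.A) ≫ G₂.map f.f = f.f ≫ B.a ≫ h.app B.A
        rw [← f.h_assoc, Category.assoc, h.naturality] }

/-- Isomorphic comonads have equivalent categories of coalgebras. -/
def coalgebraEquivOfIso {G₁ G₂ : Comonad C} (h : G₁ ≅ G₂) : G₁.Coalgebra ≌ G₂.Coalgebra where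
  functor := coalgebraFunctorOfComonadHom h.hom
  inverse := coalgebraFunctorOfComonadHom h.inv
  unitIso := NatIso.ofComponents (fun A => Comonad.Coalgebra.isoMk (Iso.refl _) (by
    have := congrArg (fun t => t.app A.A) h.hom_inv_id
    change A.a ≫ G₁.map (𝟙 A.A) = 𝟙 A.A ≫ (A.a ≫ h.hom.app A.A) ≫ h.inv.app A.A
    change h.hom.app A.A ≫ h.inv.app A.A = 𝟙 (G₁.obj A.A) at this
    simp [this]))
    (fun f => by
      ext
      exact (Category.comp_id _).trans (Category.id_comp _).symm)
  counitIso := NatIso.ofComponents (fun A => Comonad.Coalgebra.isoMk (Iso.refl _) (by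
    have := congrArg (fun t => t.app A.A) h.inv_hom_id
    change ((A.a ≫ h.inv.app A.A) ≫ h.hom.app A.A) ≫ G₂.map (𝟙 A.A) = 𝟙 A.A ≫ A.a
    change h.inv.app A.A ≫ h.hom.app A.A = 𝟙 (G₂.obj A.A) at this
    simp [this]))
    (fun f => by
      ext
      exact (Category.comp_id _).trans (Category.id_comp _).symm)
  functor_unitIso_comp A := by
    ext
    exact Category.id_comp _

end ComonadIso

/-! ### Density comonads of adjunctions -/

section Density

variable {B : Type u₁} [Category.{v₁} B] {E : Type u₂} [Category.{v₂} E]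
  {E' : Type u₃} [Category.{v₃} E']

/-- The universal property of left Kan extensions, in terms of natural transformations. -/
theorem isLeftKanExtension_of_existsUnique {D : Type*} [Category* D] {e : B ⥤ E} {F : B ⥤ D}
    (F' : E ⥤ D) (α : F ⟶ e ⋙ F')
    (h : ∀ (G : E ⥤ D) (β : F ⟶ e ⋙ G), ∃! γ : F' ⟶ G, α ≫ Functor.whiskerLeft e γ = β) :
    F'.IsLeftKanExtension α where
  nonempty_isUniversal := ⟨IsInitial.ofUniqueHom
    (fun H => StructuredArrow.homMk (h H.right H.hom).choose (h H.right H.hom).choose_spec.1)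
    (fun H m => by
      ext1
      exact (h H.right H.hom).choose_spec.2 m.right (StructuredArrow.w m))⟩

/-- If `L ⊣ R`, then `R ⋙ F` is the left Kan extension of `F` along `L`. -/
theorem isLeftKanExtension_of_adjunction {D : Type*} [Category* D] {L : E ⥤ E'} {R : E' ⥤ E}
    (adj : L ⊣ R) (F : E ⥤ D) :
    (R ⋙ F).IsLeftKanExtension (L := L) (F.leftUnitor.inv ≫ Functor.whiskerRight adj.unit F ≫
      (Functor.associator _ _ _).hom) := by
  refine isLeftKanExtension_of_existsUnique _ _ fun G β => ⟨Functor.whiskerLeft R β ≫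
        (Functor.associator _ _ _).inv ≫ Functor.whiskerRight adj.counit G ≫
        G.leftUnitor.hom, ?_, ?_⟩
  · ext b
    have := β.naturality (adj.unit.app b)
    dsimp at this
    simp [reassoc_of% this, ← Functor.map_comp]
  · rintro γ rfl
    ext X
    have n := γ.naturality (adj.counit.app X)
    dsimp at n
    simp [← n, ← Functor.map_comp_assoc]

/-- If `e` is dense and `L` is a left adjoint, then `L` is the left Kan extension of `e ⋙ L`
along `e`. -/
theorem isLeftKanExtension_of_isDense (e : B ⥤ E) [e.IsDense] {L : E ⥤ E'} {R : E' ⥤ E}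
    (adj : L ⊣ R) {e' : B ⥤ E'} (i : e' ≅ e ⋙ L) : L.IsLeftKanExtension i.hom := by
  have : ∀ c, PreservesColimit (CostructuredArrow.proj e c ⋙ e) L := fun c =>
    adj.leftAdjoint_preservesColimits.{v₁, max u₁ v₂}.preservesColimitsOfShape.preservesColimit
  -- Density makes `𝟭 E` the pointwise Kan extension of `e` along itself, and `L` preserves the
  -- colimits computing it.
  have h₁ : (𝟭 E ⋙ L).IsLeftKanExtension
      (Functor.whiskerRight e.rightUnitor.inv L ≫ (Functor.associator _ _ _).hom) :=
    Functor.PreservesLeftKanExtension.preserves (G := L) (𝟭 E) e.rightUnitor.inv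
  refine (Functor.isLeftKanExtension_iff_of_iso₂ _ _ (i.symm) L.leftUnitor ?_).1 h₁
  ext b
  simp

/-- If `e` is dense and `L ⊣ R`, then `R ⋙ L` is the left Kan extension of `e ⋙ L` along itself. -/
theorem isLeftKanExtension_comp_of_adjunction (e : B ⥤ E) [e.IsDense] {L : E ⥤ E'} {R : E' ⥤ E}
    (adj : L ⊣ R) {e' : B ⥤ E'} (i : e' ≅ e ⋙ L) (η : e' ⟶ e' ⋙ R ⋙ L)
    (hη : ∀ b, η.app b = i.hom.app b ≫ L.map (adj.unit.app (e.obj b)) ≫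
      L.map (R.map (i.inv.app b))) :
    (R ⋙ L).IsLeftKanExtension η := by
  have h₂ := isLeftKanExtension_of_isDense e adj i
  have h₃ := isLeftKanExtension_of_adjunction adj L
  -- Kan extension along `e' ≅ e ⋙ L` in two stages: `L` extends `e'` along `e`, then `R ⋙ L`
  -- extends `L` along `L`.
  refine (Functor.isLeftKanExtension_iff_postcompose i.hom e' i.symm _ η ?_).1 h₃
  ext b
  simp [hη]

/-- If `e` is dense, then the comonad of an adjunction `L ⊣ R` is the density comonad of
`e ⋙ L`. -/
theorem exists_toComonad_iso_densityComonad (e : B ⥤ E) [e.IsDense] {L : E ⥤ E'} {R : E' ⥤ E}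
    (adj : L ⊣ R) {e' : B ⥤ E'} (i : e' ≅ e ⋙ L) :
    ∃ _ : e'.HasLeftKanExtension e', Nonempty (adj.toComonad ≅ densityComonad e') := by
  let η : e' ⟶ e' ⋙ R ⋙ L := i.hom ≫ Functor.whiskerLeft e (Functor.whiskerRight adj.unit L) ≫
    Functor.whiskerRight i.inv (R ⋙ L)
  have hη : ∀ b, η.app b = i.hom.app b ≫ L.map (adj.unit.app (e.obj b)) ≫
      L.map (R.map (i.inv.app b)) := fun b => rfl
  have h := isLeftKanExtension_comp_of_adjunction e adj i η hη
  have h' : adj.toComonad.toFunctor.IsLeftKanExtension η := h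
  have : e'.HasLeftKanExtension e' := Functor.HasLeftKanExtension.mk _ η
  refine ⟨this, ⟨(densityComonadIso e' adj.toComonad η (fun b => ?_) (fun b => ?_)).symm⟩⟩
  · change η.app b ≫ adj.counit.app (e'.obj b) = _
    simp [hη]
  · change η.app b ≫ L.map (adj.unit.app (R.obj (e'.obj b))) =
      η.app b ≫ L.map (R.map (η.app b))
    have n := adj.unit.naturality (R.map (i.inv.app b))
    have n' := adj.unit.naturality (adj.unit.app (e.obj b))
    have n'' : i.inv.app b ≫ i.hom.app b = 𝟙 (L.obj (e.obj b)) := i.inv_hom_id_app b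
    dsimp at n n'
    simp only [hη, Category.assoc]
    rw [← L.map_comp (R.map (i.inv.app b)), ← L.map_comp (R.map (i.inv.app b)),
      ← R.map_comp, reassoc_of% n'', n]
    simp only [Functor.map_comp]
    rw [← L.map_comp_assoc (adj.unit.app (e.obj b)) (R.map _), ← n', Functor.map_comp_assoc]

end Density

/-- The crude comonadicity theorem, for a finite limit preserving functor, without constraints on
the universes of morphisms. -/
theorem nonempty_equivalence_coalgebra {G : Type u₁} [Category.{v₁} G] {E : Type u₂}
    [Category.{max v₂ v₁} E] [HasEqualizers G] {L : G ⥤ E} {R : E ⥤ G} (adj : L ⊣ R)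
    [PreservesFiniteLimits L] [L.ReflectsIsomorphisms] :
    Nonempty (G ≌ adj.toComonad.Coalgebra) := by
  -- Lifting the morphisms of `G` puts both categories at the same morphism level; the equivalence
  -- does not change the comonad.
  let e : G ≌ ULiftHom.{max v₂ v₁} G := ULiftHom.equiv
  let adj' : e.inverse ⋙ L ⊣ R ⋙ e.functor := e.symm.toAdjunction.comp adj
  have : PreservesFiniteLimits (e.inverse ⋙ L) := comp_preservesFiniteLimits _ _
  have : HasEqualizers (ULiftHom.{max v₂ v₁} G) :=
    Adjunction.hasLimitsOfShape_of_equivalence e.inverse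
  have : Comonad.PreservesLimitOfIsCoreflexivePair (e.inverse ⋙ L) := ⟨fun _ _ => inferInstance⟩
  let c := Comonad.comonadicOfHasPreservesCoreflexiveEqualizersOfReflectsIsomorphisms adj'
  have : (Comonad.comparison adj').IsEquivalence := c.eqv
  exact ⟨e.trans ((Comonad.comparison adj').asEquivalence.trans
    (coalgebraEquivOfIso (compToComonadIso _ adj)))⟩

theorem IsFlat.of_adjunction {B : Type u} [SmallCategory B] {E : Type u₁} [Category.{v₁} E]
    {L : (Bᵒᵖ ⥤ Type u) ⥤ E} {R : E ⥤ (Bᵒᵖ ⥤ Type u)} (adj : L ⊣ R)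
    [PreservesFiniteLimits L] {e : B ⥤ E} (i : e ≅ yoneda ⋙ L) : IsFlat e :=
  ⟨L, i.hom, isLeftKanExtension_of_isDense yoneda adj i, inferInstance⟩

/-! ### Surjections onto toposes, coalgebras and flat functors -/

section Ionad

variable {X : Type w} [Category.{u} X] (𝒳 : GeneralizedIonad X)

theorem opens_isGrothendieckTopos_of_surjection {G : Type u₁} [Category.{v₁} G]
    (f : GeometricMorphism (SmallCopresheaf X) G) (hG : IsGrothendieckTopos.{u} G)
    (hf : f.IsSurjection) (i : 𝒳.interior ≅ f.adj.toComonad) :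
    IsGrothendieckTopos.{u} 𝒳.Opens := by
  obtain ⟨C, _, J, ⟨E⟩⟩ := hG
  have := f.lex
  have : f.inverseImage.Faithful := hf
  let adj := E.symm.toAdjunction.comp f.adj
  have : PreservesFiniteLimits (E.inverse ⋙ f.inverseImage) := comp_preservesFiniteLimits _ _
  -- Categories of sheaves of sets are balanced, so a faithful functor out of one is conservative.
  have : (E.inverse ⋙ f.inverseImage).ReflectsIsomorphisms := inferInstance
  obtain ⟨E'⟩ := nonempty_equivalence_coalgebra.{_, max w u} adj
  exact ⟨C, inferInstance, J, ⟨(E'.trans ((coalgebraEquivOfIso (compToComonadIso _ f.adj)).trans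
    (coalgebraEquivOfIso i.symm))).symm⟩⟩

/-- The topos is that of coalgebras itself. Its forgetful functor creates the limits preserved by
the comonad, hence preserves finite limits once these exist downstairs. -/
theorem exists_surjection_of_opens [HasFiniteLimits (SmallCopresheaf X)]
    (h : IsGrothendieckTopos.{u} 𝒳.Opens) :
    ∃ (G : Type (u + 1)) (_ : Category.{u} G) (f : GeometricMorphism (SmallCopresheaf X) G),
        IsGrothendieckTopos.{u} G ∧ f.IsSurjection ∧
          Nonempty (𝒳.interior ≅ f.adj.toComonad) := by
  obtain ⟨C, _, J, ⟨E⟩⟩ := h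
  have := 𝒳.lex
  have : PreservesFiniteLimits 𝒳.interior.forget := ⟨fun K _ _ => inferInstance⟩
  refine ⟨Sheaf J (Type u), inferInstance,
    { inverseImage := E.inverse ⋙ 𝒳.interior.forget
      directImage := 𝒳.interior.cofree ⋙ E.functor
      adj := E.symm.toAdjunction.comp 𝒳.interior.adj
      lex := comp_preservesFiniteLimits _ _ },
    ⟨C, inferInstance, J, ⟨CategoryTheory.Equivalence.refl⟩⟩, ?_, ⟨?_⟩⟩
  · exact inferInstanceAs (E.inverse ⋙ 𝒳.interior.forget).Faithful
  · exact (Adjunction.adjToComonadIso 𝒳.interior).symm ≪≫ (compToComonadIso _ 𝒳.interior.adj).symm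

theorem exists_flat_of_surjection {G : Type u₁} [Category.{v₁} G]
    (f : GeometricMorphism (SmallCopresheaf X) G) (hG : IsGrothendieckTopos.{u} G)
    (i : 𝒳.interior ≅ f.adj.toComonad) :
    ∃ (B : Type u) (_ : SmallCategory B) (e : B ⥤ G), IsFlat e ∧
      𝒳.IsGeneratedBy (e ⋙ f.inverseImage) := by
  obtain ⟨C, _, J, ⟨E⟩⟩ := hG
  have := f.lex
  let adj := (sheafificationAdjunction J (Type u)).comp E.symm.toAdjunction
  have h₁ : PreservesFiniteLimits (presheafToSheaf J (Type u) ⋙ E.inverse) :=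
    comp_preservesFiniteLimits _ _
  have h₂ : PreservesFiniteLimits ((presheafToSheaf J (Type u) ⋙ E.inverse) ⋙ f.inverseImage) :=
    comp_preservesFiniteLimits _ _
  -- Sheaves are reflective in presheaves; this lets `compToComonadIso` discard the sheafification
  -- step.
  have : IsIso adj.counit := inferInstance
  obtain ⟨h, ⟨i'⟩⟩ := exists_toComonad_iso_densityComonad yoneda (adj.comp f.adj)
    (e' := (yoneda ⋙ presheafToSheaf J (Type u) ⋙ E.inverse) ⋙ f.inverseImage) (Iso.refl _)
  exact ⟨C, inferInstance, yoneda ⋙ presheafToSheaf J (Type u) ⋙ E.inverse,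
    .of_adjunction adj (Iso.refl _), .of_adjunction (adj.comp f.adj) (Iso.refl _), h,
    ⟨i ≪≫ (compToComonadIso adj f.adj).symm ≪≫ i'⟩⟩

end Ionad

/-! ### Surjection–inclusion factorization through sheaves -/

section Factorization

variable {B : Type u} [SmallCategory B] {E : Type u₁} [Category.{v₁} E]
  {L : (Bᵒᵖ ⥤ Type u) ⥤ E} {N : E ⥤ (Bᵒᵖ ⥤ Type u)} (adj : L ⊣ N)

include adj in
/-- A presheaf in the image of the right adjoint of `L` satisfies the sheaf condition for every
sieve whose inclusion is inverted by `L`. -/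
theorem isSheafFor_of_isIso_map {b : B} (S : Sieve b) [IsIso (L.map S.functorInclusion)] (Y : E) :
    Presieve.IsSheafFor (N.obj Y) S.arrows := by
  rw [Presieve.isSheafFor_iff_yonedaSheafCondition]
  intro f
  -- By transposition, extending `f` along the sieve becomes extending a map along an isomorphism.
  refine ⟨adj.homEquiv _ _ (inv (L.map S.functorInclusion) ≫ (adj.homEquiv _ _).symm f), ?_, ?_⟩
  · dsimp only
    rw [← adj.homEquiv_naturality_left, IsIso.hom_inv_id_assoc, Equiv.apply_symm_apply]
  · intro g hg
    apply (adj.homEquiv _ _).symm.injective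
    rw [Equiv.symm_apply_apply, ← hg, adj.homEquiv_naturality_left_symm, IsIso.inv_hom_id_assoc]

/-- The topology on `B` induced by an adjunction `L ⊣ N` between presheaves and `E`: the finest
topology for which the presheaves in the image of `N` are sheaves. -/
abbrev inducedTopology (N : E ⥤ (Bᵒᵖ ⥤ Type u)) : GrothendieckTopology B :=
  Sheaf.finestTopology (Set.range N.obj)

include adj in
theorem mem_inducedTopology {b : B} (S : Sieve b)
    (h : ∀ ⦃c : B⦄ (f : c ⟶ b), IsIso (L.map (S.pullback f).functorInclusion)) :
    S ∈ inducedTopology N b := by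
  apply Sheaf.mem_finestTopology_of_forall_isSheafFor
  rintro _ ⟨Y, rfl⟩ c f
  have := h f
  exact isSheafFor_of_isIso_map adj _ Y

/-- The map `p` factors through the sieve, so `L` sends the inclusion to a split epimorphism, and to
a monomorphism because `L` is lex. -/
theorem isIso_map_functorInclusion [PreservesFiniteLimits L] {b : B} (S : Sieve b)
    {P : Bᵒᵖ ⥤ Type u} (p : P ⟶ yoneda.obj b) [IsIso (L.map p)]
    (h : ∀ c (z : P.obj c), S (p.app c z)) : IsIso (L.map S.functorInclusion) := by
  let q : P ⟶ S.functor :=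
    { app c := ↾fun z => ⟨p.app c z, h c z⟩
      naturality c d f := by
        ext z
        apply Subtype.ext
        exact congrArg (fun t => t z) (p.naturality f) }
  have hq : q ≫ S.functorInclusion = p := rfl
  have : IsSplitEpi (L.map S.functorInclusion) := ⟨⟨{
    section_ := inv (L.map p) ≫ L.map q
    id := by rw [Category.assoc, ← L.map_comp, hq, IsIso.inv_hom_id] }⟩⟩
  exact isIso_of_mono_of_isSplitEpi _

variable {F G : Bᵒᵖ ⥤ Type u} (φ : F ⟶ G) [IsIso (L.map φ)]

/-- The pullback of `φ` along `s` has its projection inverted by `L`, and that projection lands in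
the image sieve. -/
theorem isIso_map_imageSieve [PreservesFiniteLimits L] {b : B} (s : G.obj (.op b)) :
    IsIso (L.map (Presheaf.imageSieve φ s).functorInclusion) := by
  have : IsIso (L.map (pullback.snd φ (yonedaEquiv.symm s))) :=
    (IsPullback.of_hasPullback φ (yonedaEquiv.symm s)).map L |>.isIso_snd_of_isIso
  refine isIso_map_functorInclusion _ (pullback.snd φ (yonedaEquiv.symm s)) fun c z =>
    ⟨(pullback.fst φ (yonedaEquiv.symm s)).app c z, ?_⟩
  exact congrArg (fun t => t.app c z) (pullback.condition (f := φ) (g := yonedaEquiv.symm s))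

/-- Since `L.map φ` is monic, `L` identifies the two maps classifying `x` and `y`, so it inverts the
inclusion of their equalizer. -/
theorem isIso_map_equalizerSieve [PreservesFiniteLimits L] {b : Bᵒᵖ} (x y : F.obj b)
    (h : φ.app b x = φ.app b y) :
    IsIso (L.map (Presheaf.equalizerSieve (F := F) x y).functorInclusion) := by
  have h' : L.map (yonedaEquiv.symm x) = L.map (yonedaEquiv.symm y) := by
    rw [← cancel_mono (L.map φ), ← L.map_comp, ← L.map_comp]
    congr 1
    apply yonedaEquiv.injective
    rw [yonedaEquiv_comp, yonedaEquiv_comp, Equiv.apply_symm_apply, Equiv.apply_symm_apply]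
    exact h
  have : IsIso (L.map (equalizer.ι (yonedaEquiv.symm x) (yonedaEquiv.symm y))) :=
    isIso_limit_cone_parallelPair_of_eq h'
      (isLimitOfHasEqualizerOfPreservesLimit L (yonedaEquiv.symm x) (yonedaEquiv.symm y))
  refine isIso_map_functorInclusion _
    (equalizer.ι (yonedaEquiv.symm x) (yonedaEquiv.symm y)) fun c z => ?_
  exact congrArg (fun t => t.app c z) (equalizer.condition (yonedaEquiv.symm x) (yonedaEquiv.symm y))

include adj in
theorem isLocallySurjective_inducedTopology [PreservesFiniteLimits L] :
    Presheaf.IsLocallySurjective (inducedTopology N) φ where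
  imageSieve_mem s := mem_inducedTopology adj _ fun c f => by
    rw [Presheaf.pullback_imageSieve]
    exact isIso_map_imageSieve φ _

include adj in
theorem isLocallyInjective_inducedTopology [PreservesFiniteLimits L] :
    Presheaf.IsLocallyInjective (inducedTopology N) φ where
  equalizerSieve_mem {b} x y h := mem_inducedTopology adj _ fun c f => by
    have e : (Presheaf.equalizerSieve (F := F) x y).pullback f =
        Presheaf.equalizerSieve (F := F) (F.map f.op x) (F.map f.op y) := by
      ext d g
      simp
    rw [e]
    refine isIso_map_equalizerSieve φ _ _ ?_
    have n := fun z => congrArg (fun t => t z) (φ.naturality f.op)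
    exact (n x).trans ((congrArg (G.map f.op) h).trans (n y).symm)

include adj in
theorem reflectsIsomorphisms_sheafToPresheaf_comp [PreservesFiniteLimits L] :
    (sheafToPresheaf (inducedTopology N) (Type u) ⋙ L).ReflectsIsomorphisms where
  reflects {F G} f hf := by
    have : IsIso (L.map f.hom) := hf
    exact (Sheaf.isLocallyBijective_iff_isIso f).1
      ⟨isLocallyInjective_inducedTopology adj f.hom, isLocallySurjective_inducedTopology adj f.hom⟩

/-- A finite limit preserving functor which reflects isomorphisms is faithful. -/
theorem faithful_of_reflectsIsomorphisms {C : Type u₁} [Category.{v₁} C] [HasEqualizers C]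
    {D : Type u₂} [Category.{v₂} D] (K : C ⥤ D) [PreservesFiniteLimits K]
    [K.ReflectsIsomorphisms] : K.Faithful where
  map_injective {X Y f g} h := by
    have : IsIso (K.map (equalizer.ι f g)) :=
      isIso_limit_cone_parallelPair_of_eq h (isLimitOfHasEqualizerOfPreservesLimit K f g)
    have := isIso_of_reflects_iso (equalizer.ι f g) K
    exact eq_of_epi_equalizer

/-- The right adjoint `N` takes values in sheaves for the induced topology. -/
def sheafOfRightAdjoint (N : E ⥤ (Bᵒᵖ ⥤ Type u)) : E ⥤ Sheaf (inducedTopology N) (Type u) :=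
  ObjectProperty.lift _ N fun Y => (isSheaf_iff_isSheaf_of_type _ _).2
    (Sheaf.sheaf_for_finestTopology _ (Set.mem_range_self Y))

/-- The restriction of an adjunction to sheaves for the induced topology. -/
def sheafAdjunction : sheafToPresheaf (inducedTopology N) (Type u) ⋙ L ⊣ sheafOfRightAdjoint N :=
  Adjunction.mkOfUnitCounit
    { unit := { app F := ⟨adj.unit.app F.obj⟩
                naturality F G f := by
                  ext1
                  exact adj.unit.naturality f.hom }
      counit := { app Y := adj.counit.app Y
                  naturality Y Z f := adj.counit.naturality f }
      left_triangle := by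
        ext F
        have := adj.left_triangle_components F.obj
        change L.map (adj.unit.app F.obj) ≫ 𝟙 _ ≫ adj.counit.app (L.obj F.obj) = 𝟙 _
        simp
      right_triangle := by
        ext1
        ext1 Y
        ext1
        change adj.unit.app (N.obj Y) ≫ 𝟙 _ ≫ N.map (adj.counit.app Y) = 𝟙 _
        simp }

/-- Every adjunction between presheaves and `E` whose left adjoint preserves finite limits
induces the same comonad as some geometric surjection onto sheaves. -/
theorem exists_surjection_of_adjunction [PreservesFiniteLimits L] :
    ∃ (J : GrothendieckTopology B) (f : GeometricMorphism E (Sheaf J (Type u))),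
      f.IsSurjection ∧ Nonempty (adj.toComonad ≅ f.adj.toComonad) := by
  have := reflectsIsomorphisms_sheafToPresheaf_comp adj
  have h : PreservesFiniteLimits (sheafToPresheaf (inducedTopology N) (Type u) ⋙ L) :=
    comp_preservesFiniteLimits _ _
  refine ⟨inducedTopology N, ⟨_, _, sheafAdjunction adj, h⟩, ?_, ⟨?_⟩⟩
  · exact faithful_of_reflectsIsomorphisms (sheafToPresheaf (inducedTopology N) (Type u) ⋙ L)
  -- Regarding `N Y` as a sheaf and forgetting again gives `N Y`, so both comonads have the same
  -- underlying functor.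
  · exact ComonadIso.mk (Iso.refl _) (fun Y => Category.id_comp _) (fun Y => by
      change 𝟙 _ ≫ L.map (adj.unit.app (N.obj Y)) = L.map (adj.unit.app (N.obj Y)) ≫ 𝟙 _ ≫ L.map (N.map (𝟙 _))
      simp)

end Factorization

/-! ### Kan extensions along Yoneda are left adjoints -/

section Yoneda

variable {B : Type u} [SmallCategory B] {E : Type u₁}

/-- A left Kan extension along the Yoneda embedding of a functor into a locally small cocomplete
category is an extension and a left adjoint. -/
theorem isLeftAdjoint_of_isLeftKanExtension_yoneda_of_category [Category.{u} E]
    [HasColimitsOfSize.{u, u} E] {e : B ⥤ E} (L : (Bᵒᵖ ⥤ Type u) ⥤ E) (α : e ⟶ yoneda ⋙ L)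
    [L.IsLeftKanExtension α] : IsIso α ∧ L.IsLeftAdjoint := by
  let j : yoneda (C := B) ≅ uliftYoneda.{u} := uliftYonedaIsoYoneda.symm
  let α' : e ⟶ uliftYoneda.{u} ⋙ L := α ≫ Functor.whiskerRight j.hom L
  have : L.IsLeftKanExtension α' := by
    refine isLeftKanExtension_of_existsUnique _ _ fun G β =>
      ⟨L.descOfIsLeftKanExtension α G (β ≫ Functor.whiskerRight j.inv G), ?_, fun γ hγ => ?_⟩
    · ext b
      have n := (L.descOfIsLeftKanExtension α G (β ≫ Functor.whiskerRight j.inv G)).naturality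
        (j.hom.app b)
      simp [α', ← G.map_comp, n]
    · refine L.hom_ext_of_isLeftKanExtension α _ _ ?_
      ext b
      simp [← hγ, α']
  have h := Presheaf.isIso_of_isLeftKanExtension.{u} L α'
  refine ⟨?_, ⟨_, ⟨Presheaf.uliftYonedaAdjunction.{u} L α'⟩⟩⟩
  have : α = α' ≫ Functor.whiskerRight j.inv L := by
    simp [α', ← Functor.whiskerRight_comp]
  rw [this]
  infer_instance

/-- Transformations between copresheaves on a large category need not live in `Type u`. Local
smallness allows replacing `E` by the equivalent `ShrinkHoms E`. -/
theorem isLeftAdjoint_of_isLeftKanExtension_yoneda [Category.{v₁} E] [LocallySmall.{u} E]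
    [HasColimitsOfSize.{u, u} E] {e : B ⥤ E} (L : (Bᵒᵖ ⥤ Type u) ⥤ E) (α : e ⟶ yoneda ⋙ L)
    [L.IsLeftKanExtension α] : IsIso α ∧ L.IsLeftAdjoint := by
  let S := ShrinkHoms.equivalence.{u} E
  have : HasColimitsOfSize.{u, u} (ShrinkHoms E) :=
    Adjunction.has_colimits_of_equivalence S.inverse
  have : (L ⋙ S.functor).IsLeftKanExtension
      (Functor.whiskerRight α S.functor ≫ (Functor.associator _ _ _).hom) := inferInstance
  obtain ⟨h, h'⟩ := isLeftAdjoint_of_isLeftKanExtension_yoneda_of_category _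
    (Functor.whiskerRight α S.functor ≫ (Functor.associator _ _ _).hom)
  constructor
  · have : ∀ b, IsIso (α.app b) := fun b => by
      have h₁ : IsIso ((Functor.whiskerRight α S.functor ≫
        (Functor.associator _ _ _).hom).app b) := inferInstance
      have h₂ : IsIso (S.functor.map (α.app b)) := by simpa using h₁
      exact isIso_of_reflects_iso _ S.functor
    exact NatIso.isIso_of_isIso_app α
  · let i : (L ⋙ S.functor) ⋙ S.inverse ≅ L := Functor.associator _ _ _ ≪≫
      Functor.isoWhiskerLeft L S.unitIso.symm ≪≫ L.rightUnitor
    exact Functor.isLeftAdjoint_of_iso i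

end Yoneda

/-! ### Closure of the locus where a transformation is invertible -/

section IsoClosure

variable {C : Type u₁} [Category.{v₁} C] {D : Type u₂} [Category.{v₂} D] {F G : C ⥤ D}
  (α : F ⟶ G) {J : Type*} [Category* J] {K : J ⥤ C}

theorem isIso_app_of_isColimit {c : Cocone K} (hc : IsColimit c) [PreservesColimit K F]
    [PreservesColimit K G] (h : ∀ j, IsIso (α.app (K.obj j))) : IsIso (α.app c.pt) := by
  have : IsIso (Functor.whiskerLeft K α) := by
    have : ∀ j, IsIso ((Functor.whiskerLeft K α).app j) := h
    exact NatIso.isIso_of_isIso_app _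
  have e : ((isColimitOfPreserves F hc).coconePointsIsoOfNatIso (isColimitOfPreserves G hc)
      (asIso (Functor.whiskerLeft K α))).hom = α.app c.pt := by
    refine (isColimitOfPreserves F hc).hom_ext fun j => ?_
    rw [IsColimit.comp_coconePointsIsoOfNatIso_hom]
    exact (α.naturality (c.ι.app j)).symm
  rw [← e]
  infer_instance

theorem isIso_app_of_isLimit {c : Cone K} (hc : IsLimit c) [PreservesLimit K F]
    [PreservesLimit K G] (h : ∀ j, IsIso (α.app (K.obj j))) : IsIso (α.app c.pt) := by
  have : IsIso (Functor.whiskerLeft K α) := by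
    have : ∀ j, IsIso ((Functor.whiskerLeft K α).app j) := h
    exact NatIso.isIso_of_isIso_app _
  have e : ((isLimitOfPreserves F hc).conePointsIsoOfNatIso (isLimitOfPreserves G hc)
      (asIso (Functor.whiskerLeft K α))).hom = α.app c.pt := by
    refine (isLimitOfPreserves G hc).hom_ext fun j => ?_
    rw [IsLimit.conePointsIsoOfNatIso_hom_comp]
    exact α.naturality (c.π.app j)
  rw [← e]
  infer_instance

end IsoClosure

/-! ### Copresheaves extended from a small category -/

section Extended

variable {A : Type u} [SmallCategory A] {X : Type w} [Category.{u} X] (i : A ⥤ X)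

/-- The copresheaves which are left Kan extensions of their restriction along `i`. -/
def isExtendedFrom : ObjectProperty (X ⥤ Type u) := fun F => F.IsLeftKanExtension (𝟙 (i ⋙ F))

theorem isExtendedFrom_iff (F : X ⥤ Type u) :
    isExtendedFrom i F ↔ IsIso ((i.lanAdjunction (Type u)).counit.app F) :=
  (i.isIso_lanAdjunction_counit_app_iff F).symm

instance : (isExtendedFrom i).IsClosedUnderIsomorphisms where
  of_iso {F G} e h := by
    rw [isExtendedFrom_iff] at h ⊢
    exact (NatTrans.isIso_app_iff_of_iso _ e).1 h

instance (J : Type u) [SmallCategory J] : (isExtendedFrom i).IsClosedUnderColimitsOfShape J where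
  colimitsOfShape_le := by
    rintro F ⟨h⟩
    rw [isExtendedFrom_iff]
    have : PreservesColimitsOfSize.{u, u} i.lan :=
      (i.lanAdjunction (Type u)).leftAdjoint_preservesColimits
    have : PreservesColimit h.diag ((Functor.whiskeringLeft A X (Type u)).obj i ⋙ i.lan) :=
      comp_preservesColimit _ _
    exact isIso_app_of_isColimit (G := 𝟭 _) (c := Cocone.mk F h.ι)
      (i.lanAdjunction (Type u)).counit h.isColimit
      fun j => (isExtendedFrom_iff i _).1 (h.prop_diag_obj j)

/-- This is the Yoneda lemma on both sides: by fullness, a map out of the restricted corepresentable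
is also determined by the image of the identity of `i.obj a`. -/
theorem isExtendedFrom_coyoneda [i.Full] (a : A) :
    isExtendedFrom i (coyoneda.obj (.op (i.obj a))) := by
  refine isLeftKanExtension_of_existsUnique _ _ fun G β =>
    ⟨coyonedaEquiv.symm (β.app a (𝟙 (i.obj a))), ?_, fun γ hγ => ?_⟩
  · ext b f
    obtain ⟨g, rfl⟩ := i.map_surjective f
    have n : β.app b (𝟙 (i.obj a) ≫ i.map g) = G.map (i.map g) (β.app a (𝟙 (i.obj a))) :=
      congrArg (fun t => t (𝟙 (i.obj a))) (β.naturality g)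
    rw [Category.id_comp] at n
    exact n.symm
  · apply coyonedaEquiv.injective
    rw [Equiv.apply_symm_apply, ← hγ]
    rfl

/-- A copresheaf extended from a small category is small. -/
theorem isExtendedFrom_le_isSmallCopresheaf : isExtendedFrom i ≤ isSmallCopresheaf X := by
  intro F hF
  have : F.IsLeftKanExtension (𝟙 (i ⋙ F)) := hF
  -- Elements of the restriction form a small category. A cocone under the associated
  -- corepresentables amounts to a map `i ⋙ F ⟶ i ⋙ s.pt`, which extends uniquely to `F`.
  let D : (i ⋙ F).Elementsᵒᵖ ⥤ X ⥤ Type u := (CategoryOfElements.π (i ⋙ F) ⋙ i).op ⋙ coyoneda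
  let c : Cocone D :=
    { pt := F
      ι := { app x := coyonedaEquiv.symm x.unop.2
             naturality x y f := by
               have h : F.map (i.map f.unop.1) y.unop.2 = x.unop.2 := f.unop.2
               refine Eq.trans ?_ (Category.comp_id _).symm
               rw [← h]
               exact (coyonedaEquiv_symm_map (i.map f.unop.1) (F := F) y.unop.2).symm } }
  let σ (s : Cocone D) (a : A) (x : F.obj (i.obj a)) : coyoneda.obj (.op (i.obj a)) ⟶ s.pt :=
    s.ι.app (.op ⟨a, x⟩)
  have hσ (s : Cocone D) {a b : A} (f : a ⟶ b) (x : F.obj (i.obj a)) :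
      coyoneda.map (i.map f).op ≫ σ s a x = σ s b (F.map (i.map f) x) :=
    s.w (Quiver.Hom.op (CategoryOfElements.homMk (F := i ⋙ F) ⟨a, x⟩ ⟨b, F.map (i.map f) x⟩ f rfl))
  let β (s : Cocone D) : i ⋙ F ⟶ i ⋙ s.pt :=
    { app a := ↾fun x => coyonedaEquiv (X := i.obj a) (F := s.pt) (σ s a x)
      naturality a b f := by
        ext x
        change coyonedaEquiv (X := i.obj b) (F := s.pt) (σ s b (F.map (i.map f) x)) =
          s.pt.map (i.map f) (coyonedaEquiv (X := i.obj a) (F := s.pt) (σ s a x))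
        rw [coyonedaEquiv_naturality, hσ] }
  refine ⟨(i ⋙ F).Elementsᵒᵖ, inferInstance, D, c,
    fun j => inferInstanceAs (coyoneda.obj (.op (i.obj j.unop.1))).IsCorepresentable,
    ⟨?_⟩, ⟨Iso.refl _⟩⟩
  exact
    { desc s := F.descOfIsLeftKanExtension (𝟙 _) s.pt (β s)
      fac s x := by
        have h := F.descOfIsLeftKanExtension_fac_app (𝟙 _) s.pt (β s) x.unop.1
        have h' : (coyonedaEquiv (X := i.obj x.unop.1) (F := F)).symm x.unop.2 ≫
            F.descOfIsLeftKanExtension (𝟙 _) s.pt (β s) = σ s x.unop.1 x.unop.2 := by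
          apply coyonedaEquiv.injective
          rw [coyonedaEquiv_comp, Equiv.apply_symm_apply]
          exact congrArg (fun t => t x.unop.2) h
        exact h'
      uniq s m hm := by
        refine F.hom_ext_of_isLeftKanExtension (𝟙 (i ⋙ F)) _ _ ?_
        rw [Functor.descOfIsLeftKanExtension_fac]
        ext a x
        have h : (coyonedaEquiv (X := i.obj a) (F := F)).symm x ≫ m = σ s a x := hm (.op ⟨a, x⟩)
        change m.app (i.obj a) x = coyonedaEquiv (X := i.obj a) (F := s.pt) (σ s a x)
        rw [← h, coyonedaEquiv_comp, Equiv.apply_symm_apply] }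

/-- The value at `x` of the left Kan extension along `i` is the colimit over the costructured
arrows over `x`. -/
noncomputable def lanCompEvaluationIso (x : X) :
    i.lan ⋙ (evaluation X (Type u)).obj x ≅
      (Functor.whiskeringLeft _ _ (Type u)).obj (CostructuredArrow.proj i x) ⋙ colim :=
  NatIso.ofComponents (fun G => IsColimit.coconePointUniqueUpToIso
      (Functor.isPointwiseLeftKanExtensionLeftKanExtensionUnit i G x) (colimit.isColimit _))
    (fun {G₁ G₂} φ => by
      apply (Functor.isPointwiseLeftKanExtensionLeftKanExtensionUnit i G₁ x).hom_ext
      intro T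
      let P (G : A ⥤ Type u) := Functor.isPointwiseLeftKanExtensionLeftKanExtensionUnit i G x
      let c (G : A ⥤ Type u) := (i.lanUnit.app G).app T.left ≫ (i.lan.obj G).map T.hom
      let ψ (G : A ⥤ Type u) : (i.lan.obj G).obj x ⟶ colimit (CostructuredArrow.proj i x ⋙ G) :=
        ((P G).coconePointUniqueUpToIso (colimit.isColimit _)).hom
      have h₁ (G) : c G ≫ ψ G = colimit.ι (CostructuredArrow.proj i x ⋙ G) T :=
        IsColimit.comp_coconePointUniqueUpToIso_hom (P G) (colimit.isColimit _) T
      have h₂ : c G₁ ≫ (i.lan.map φ).app x = φ.app T.left ≫ c G₂ := by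
        have := congr_app (i.lanUnit.naturality φ) T.left
        dsimp at this
        simp only [c, Category.assoc, NatTrans.naturality, reassoc_of% this]
      have h₃ : colimit.ι (CostructuredArrow.proj i x ⋙ G₁) T ≫
          colimMap (Functor.whiskerLeft (CostructuredArrow.proj i x) φ) =
            φ.app T.left ≫ colimit.ι (CostructuredArrow.proj i x ⋙ G₂) T :=
        ι_colimMap _ _
      change c G₁ ≫ (i.lan.map φ).app x ≫ ψ G₂ = c G₁ ≫ ψ G₁ ≫
        colimMap (Functor.whiskerLeft (CostructuredArrow.proj i x) φ)
      rw [reassoc_of% h₂, h₁, reassoc_of% h₁]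
      exact h₃.symm)

/-- Pointwise the extension is a filtered colimit of sets, which commutes with finite limits. -/
theorem preservesFiniteLimits_lan [∀ x, IsFiltered (CostructuredArrow i x)] :
    PreservesFiniteLimits (i.lan : (A ⥤ Type u) ⥤ (X ⥤ Type u)) where
  preservesFiniteLimits J _ _ := by
    apply preservesLimitsOfShape_of_evaluation
    intro x
    exact preservesLimitsOfShape_of_natIso (lanCompEvaluationIso i x).symm

instance [∀ x, IsFiltered (CostructuredArrow i x)] (J : Type) [SmallCategory J] [FinCategory J] :
    (isExtendedFrom i).IsClosedUnderLimitsOfShape J where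
  limitsOfShape_le := by
    rintro F ⟨h⟩
    rw [isExtendedFrom_iff]
    have := preservesFiniteLimits_lan i
    have : PreservesLimit h.diag ((Functor.whiskeringLeft A X (Type u)).obj i ⋙ i.lan) :=
      comp_preservesLimit _ _
    exact isIso_app_of_isLimit (G := 𝟭 _) (c := Cone.mk F h.π)
      (i.lanAdjunction (Type u)).counit h.isLimit
      fun j => (isExtendedFrom_iff i _).1 (h.prop_diag_obj j)

end Extended

/-! ### Small filtering sets of objects -/

section Closure

variable {X : Type w} [Category.{u} X]

/-- A set of objects of `X` is *filtering* if it contains an object mapping to any given object,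
and weak coproducts and weak coequalizers for diagrams in the set. -/
structure IsFiltering (S : Set X) : Prop where
  nonempty (y : X) : ∃ c ∈ S, Nonempty (c ⟶ y)
  cocone_objs {a b : X} (ha : a ∈ S) (hb : b ∈ S) {y : X} (f : a ⟶ y) (g : b ⟶ y) :
    ∃ c ∈ S, ∃ (i : a ⟶ c) (j : b ⟶ c) (h : c ⟶ y), i ≫ h = f ∧ j ≫ h = g
  cocone_maps {a b : X} (ha : a ∈ S) (hb : b ∈ S) (p q : a ⟶ b) {y : X} (h : b ⟶ y)
    (w : p ≫ h = q ≫ h) : ∃ c ∈ S, ∃ (r : b ⟶ c) (k : c ⟶ y), p ≫ r = q ≫ r ∧ r ≫ k = h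

theorem HasPreColimit.exists_small {J : Type u₁} [Category.{v₁} J] {D : J ⥤ X}
    (h : HasPreColimit D) : ∃ T : Set X, Small.{u} T ∧
      ∀ s : Cocone D, ∃ c : Cocone D, c.pt ∈ T ∧ Nonempty (c ⟶ s) := by
  obtain ⟨I, c, hc⟩ := h
  exact ⟨Set.range fun i => (c i).pt, inferInstance, fun s =>
    (hc s).elim fun i hi => ⟨c i, ⟨i, rfl⟩, hi⟩⟩

theorem FinitelyPreCocomplete.exists_weakly_initial (hX : FinitelyPreCocomplete X) :
    ∃ T : Set X, Small.{u} T ∧ ∀ y, ∃ c ∈ T, Nonempty (c ⟶ y) := by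
  obtain ⟨T, hT, h⟩ := (hX (Discrete PEmpty.{1}) (Functor.empty X)).exists_small
  refine ⟨T, hT, fun y => ?_⟩
  obtain ⟨c, hc, ⟨k⟩⟩ := h (asEmptyCocone y)
  exact ⟨c.pt, hc, ⟨k.hom⟩⟩

theorem FinitelyPreCocomplete.exists_weak_coproducts (hX : FinitelyPreCocomplete X) (a b : X) :
    ∃ T : Set X, Small.{u} T ∧ ∀ (y : X) (f : a ⟶ y) (g : b ⟶ y),
      ∃ c ∈ T, ∃ (i : a ⟶ c) (j : b ⟶ c) (h : c ⟶ y), i ≫ h = f ∧ j ≫ h = g := by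
  obtain ⟨T, hT, h⟩ := (hX (Discrete WalkingPair) (pair a b)).exists_small
  refine ⟨T, hT, fun y f g => ?_⟩
  obtain ⟨c, hc, ⟨k⟩⟩ := h (BinaryCofan.mk f g)
  exact ⟨c.pt, hc, c.ι.app ⟨.left⟩, c.ι.app ⟨.right⟩, k.hom, k.w ⟨.left⟩, k.w ⟨.right⟩⟩

theorem FinitelyPreCocomplete.exists_weak_coequalizers (hX : FinitelyPreCocomplete X) {a b : X}
    (p q : a ⟶ b) : ∃ T : Set X, Small.{u} T ∧ ∀ (y : X) (h : b ⟶ y), p ≫ h = q ≫ h →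
      ∃ c ∈ T, ∃ (r : b ⟶ c) (k : c ⟶ y), p ≫ r = q ≫ r ∧ r ≫ k = h := by
  obtain ⟨T, hT, h⟩ := (hX WalkingParallelPair (parallelPair p q)).exists_small
  refine ⟨T, hT, fun y f w => ?_⟩
  obtain ⟨c, hc, ⟨k⟩⟩ := h (Cofork.ofπ f w)
  exact ⟨c.pt, hc, c.ι.app .one, k.hom, Cofork.condition c, k.w .one⟩

/-- Every small set of objects of a finitely pre-cocomplete category is contained in a small
filtering set. -/
theorem FinitelyPreCocomplete.exists_isFiltering (hX : FinitelyPreCocomplete X) (S₀ : Set X)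
    [Small.{u} S₀] : ∃ S : Set X, S₀ ⊆ S ∧ Small.{u} S ∧ IsFiltering S := by
  obtain ⟨T₀, _, h₀⟩ := hX.exists_weakly_initial
  choose T₂ hT₂ h₂ using hX.exists_weak_coproducts
  choose T₃ hT₃ h₃ using fun a b => hX.exists_weak_coequalizers (a := a) (b := b)
  -- Adjoin weak coproducts of all pairs and weak coequalizers of all parallel pairs. After
  -- countably many rounds the union is closed, as any two objects already lie in a common stage.
  let step (S : Set X) : Set X := S ∪ ((⋃ a : S, ⋃ b : S, T₂ a b) ∪
    ⋃ a : S, ⋃ b : S, ⋃ p : a.1 ⟶ b.1, ⋃ q : a.1 ⟶ b.1, T₃ a b p q)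
  let R (n : ℕ) : Set X := step^[n] (S₀ ∪ T₀)
  have hR (n : ℕ) : R (n + 1) = step (R n) := Function.iterate_succ_apply' _ _ _
  have hsmall (n : ℕ) : Small.{u} (R n) := by
    induction n with
    | zero => exact small_union _ _
    | succ n ih => rw [hR]; infer_instance
  have hmono : Monotone R := monotone_nat_of_le_succ fun n => by
    rw [hR]; exact Set.subset_union_left
  have hpair {a b : X} (ha : a ∈ ⋃ n, R n) (hb : b ∈ ⋃ n, R n) : ∃ n, a ∈ R n ∧ b ∈ R n := by
    obtain ⟨m, hm⟩ := Set.mem_iUnion.1 ha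
    obtain ⟨n, hn⟩ := Set.mem_iUnion.1 hb
    exact ⟨max m n, hmono (le_max_left _ _) hm, hmono (le_max_right _ _) hn⟩
  refine ⟨⋃ n, R n, fun x hx => Set.mem_iUnion.2 ⟨0, Or.inl hx⟩, inferInstance, ?_, ?_, ?_⟩
  · intro y
    obtain ⟨c, hc, hcy⟩ := h₀ y
    exact ⟨c, Set.mem_iUnion.2 ⟨0, Or.inr hc⟩, hcy⟩
  · intro a b ha hb y f g
    obtain ⟨n, ha, hb⟩ := hpair ha hb
    obtain ⟨c, hc, h⟩ := h₂ a b y f g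
    refine ⟨c, Set.mem_iUnion.2 ⟨n + 1, ?_⟩, h⟩
    rw [hR]
    exact Or.inr (Or.inl (Set.mem_iUnion₂.2 ⟨⟨a, ha⟩, ⟨b, hb⟩, hc⟩))
  · intro a b ha hb p q y f w
    obtain ⟨n, ha, hb⟩ := hpair ha hb
    obtain ⟨c, hc, h⟩ := h₃ a b p q y f w
    refine ⟨c, Set.mem_iUnion.2 ⟨n + 1, ?_⟩, h⟩
    rw [hR]
    exact Or.inr (Or.inr (Set.mem_iUnion₂.2 ⟨⟨a, ha⟩, ⟨b, hb⟩, Set.mem_iUnion₂.2 ⟨p, q, hc⟩⟩))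

/-- A small model of the full subcategory of `X` on the small set `S`. -/
abbrev SmallFullSubcategory (S : Set X) [Small.{u} S] : Type u :=
  InducedCategory X fun k : Shrink.{u} S => ((equivShrink S).symm k : X)

/-- The inclusion of the small full subcategory on `S`. -/
noncomputable abbrev smallInclusion (S : Set X) [Small.{u} S] : SmallFullSubcategory S ⥤ X :=
  inducedFunctor _

theorem exists_smallInclusion_obj_eq (S : Set X) [Small.{u} S] {x : X} (hx : x ∈ S) :
    ∃ a, (smallInclusion S).obj a = x :=
  ⟨equivShrink S ⟨x, hx⟩, congrArg Subtype.val ((equivShrink S).symm_apply_apply _)⟩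

theorem smallInclusion_obj_mem (S : Set X) [Small.{u} S] (a : SmallFullSubcategory S) :
    (smallInclusion S).obj a ∈ S :=
  ((equivShrink S).symm a).2

/-- Weak cocones with apex in `S` lift to the slice because the inclusion is full and faithful. -/
theorem IsFiltering.isFiltered {S : Set X} [Small.{u} S] (hS : IsFiltering S) (x : X) :
    IsFiltered (CostructuredArrow (smallInclusion S) x) := by
  have lift {c : X} (hc : c ∈ S) : ∃ a, (smallInclusion S).obj a = c :=
    exists_smallInclusion_obj_eq S hc
  refine { cocone_objs := fun P Q => ?_, cocone_maps := fun P Q f g => ?_, nonempty := ?_ }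
  · obtain ⟨c, hc, i, j, h, hi, hj⟩ := hS.cocone_objs (smallInclusion_obj_mem S P.left)
      (smallInclusion_obj_mem S Q.left) P.hom Q.hom
    obtain ⟨c, rfl⟩ := lift hc
    exact ⟨CostructuredArrow.mk (Y := c) h,
      CostructuredArrow.homMk ((smallInclusion S).preimage i) (by
        rw [Functor.map_preimage]; exact hi),
      CostructuredArrow.homMk ((smallInclusion S).preimage j) (by
        rw [Functor.map_preimage]; exact hj), trivial⟩
  · obtain ⟨c, hc, r, k, hr, hk⟩ := hS.cocone_maps (smallInclusion_obj_mem S P.left)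
      (smallInclusion_obj_mem S Q.left) ((smallInclusion S).map f.left)
      ((smallInclusion S).map g.left) Q.hom
      ((CostructuredArrow.w f).trans (CostructuredArrow.w g).symm)
    obtain ⟨c, rfl⟩ := lift hc
    refine ⟨CostructuredArrow.mk (Y := c) k,
      CostructuredArrow.homMk ((smallInclusion S).preimage r) (by
        rw [Functor.map_preimage]; exact hk), ?_⟩
    apply CostructuredArrow.hom_ext
    apply (smallInclusion S).map_injective
    change (smallInclusion S).map (f.left ≫ (smallInclusion S).preimage r) =
      (smallInclusion S).map (g.left ≫ (smallInclusion S).preimage r)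
    rw [Functor.map_comp, Functor.map_comp, Functor.map_preimage]
    exact hr
  · obtain ⟨c, hc, ⟨h⟩⟩ := hS.nonempty x
    obtain ⟨c, rfl⟩ := lift hc
    exact ⟨CostructuredArrow.mk (Y := c) h⟩

end Closure

/-! ### Limits, colimits and local smallness of small copresheaves -/

section SmallCopresheaf

variable {X : Type w} [Category.{u} X]

/-- It suffices that `S` contain the corepresenting objects of a presentation. Allowing every larger
`S` lets a small family share one subcategory. -/
theorem isSmallCopresheaf.exists_isExtendedFrom {F : X ⥤ Type u} (hF : isSmallCopresheaf X F) :
    ∃ T : Set X, Small.{u} T ∧ ∀ (S : Set X) [Small.{u} S], T ⊆ S →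
      isExtendedFrom (smallInclusion S) F := by
  obtain ⟨J, _, D, c, hD, ⟨hc⟩, ⟨i⟩⟩ := hF
  refine ⟨Set.range fun j => (D.obj j).coreprX, inferInstance, fun S _ hS => ?_⟩
  refine (isExtendedFrom (smallInclusion S)).prop_of_iso i ?_
  refine ObjectProperty.prop_of_isColimit _ hc fun j => ?_
  refine (isExtendedFrom (smallInclusion S)).prop_of_iso (D.obj j).coreprW ?_
  obtain ⟨a, ha⟩ : ∃ a, (smallInclusion S).obj a = (D.obj j).coreprX :=
    exists_smallInclusion_obj_eq S (hS ⟨j, rfl⟩)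
  rw [← ha]
  exact isExtendedFrom_coyoneda _ a

theorem exists_isExtendedFrom_family {J : Type*} [Small.{u} J] (F : J → X ⥤ Type u)
    (hF : ∀ j, isSmallCopresheaf X (F j)) :
    ∃ T : Set X, Small.{u} T ∧ ∀ (S : Set X) [Small.{u} S], T ⊆ S →
      ∀ j, isExtendedFrom (smallInclusion S) (F j) := by
  choose T hT h using fun j => (hF j).exists_isExtendedFrom
  exact ⟨⋃ j, T j, inferInstance, fun S _ hS j => h j S ((Set.subset_iUnion T j).trans hS)⟩

instance : (isSmallCopresheaf X).IsClosedUnderIsomorphisms where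
  of_iso e h := by
    obtain ⟨J, _, D, c, hD, hc, ⟨i⟩⟩ := h
    exact ⟨J, _, D, c, hD, hc, ⟨i ≪≫ e⟩⟩

instance (J : Type u) [SmallCategory J] : (isSmallCopresheaf X).IsClosedUnderColimitsOfShape J where
  colimitsOfShape_le := by
    rintro F ⟨h⟩
    obtain ⟨S, _, hS⟩ := exists_isExtendedFrom_family h.diag.obj h.prop_diag_obj
    exact isExtendedFrom_le_isSmallCopresheaf (smallInclusion S) _
      (ObjectProperty.prop_of_isColimit _ h.isColimit (hS S subset_rfl))

/-- All vertices of the diagram are extended from one small filtering set, where extension is lex;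
hence so is the limit. -/
theorem FinitelyPreCocomplete.isClosedUnderLimitsOfShape (hX : FinitelyPreCocomplete X) (J : Type)
    [SmallCategory J] [FinCategory J] : (isSmallCopresheaf X).IsClosedUnderLimitsOfShape J where
  limitsOfShape_le := by
    rintro F ⟨h⟩
    obtain ⟨T, _, hT⟩ := exists_isExtendedFrom_family h.diag.obj h.prop_diag_obj
    obtain ⟨S, hTS, _, hS⟩ := hX.exists_isFiltering T
    have := hS.isFiltered
    exact isExtendedFrom_le_isSmallCopresheaf (smallInclusion S) _
      (ObjectProperty.prop_of_isLimit _ h.isLimit (hT S hTS))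

instance : HasColimitsOfSize.{u, u} (SmallCopresheaf X) where
  has_colimits_of_shape J _ := hasColimitsOfShape_of_closedUnderColimits J _

theorem FinitelyPreCocomplete.hasFiniteLimits (hX : FinitelyPreCocomplete X) :
    HasFiniteLimits (SmallCopresheaf X) where
  out J _ _ :=
    have := hX.isClosedUnderLimitsOfShape J
    hasLimitsOfShape_of_closedUnderLimits J _

/-- A map out of a small colimit of corepresentables is determined by a small family of elements of
the target. -/
instance : LocallySmall.{u} (SmallCopresheaf X) where
  hom_small F G := by
    obtain ⟨J, _, D, c, hD, ⟨hc⟩, ⟨i⟩⟩ := F.property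
    have (j : J) : Small.{u} (D.obj j ⟶ G.obj) :=
      small_of_injective ((Iso.homCongr (D.obj j).coreprW.symm (Iso.refl _)).trans
        coyonedaEquiv).injective
    let φ (f : F ⟶ G) (j : J) : D.obj j ⟶ G.obj := c.ι.app j ≫ i.hom ≫ f.hom
    refine small_of_injective (f := φ) fun f g h => ?_
    apply ObjectProperty.hom_ext
    rw [← cancel_epi i.hom]
    exact hc.hom_ext fun j => congrFun h j

end SmallCopresheaf

/-- The topos consists of sheaves on `B` itself, for the topology induced by the right adjoint of
the extension of `e`. -/
theorem exists_surjection_of_isGeneratedBy {X : Type w} [Category.{u} X] (𝒳 : GeneralizedIonad X)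
    {B : Type u} [SmallCategory B] {e : B ⥤ SmallCopresheaf X} (he : 𝒳.IsGeneratedBy e) :
    ∃ (G : Type (u + 1)) (_ : Category.{u} G) (f : GeometricMorphism (SmallCopresheaf X) G),
        IsGrothendieckTopos.{u} G ∧ f.IsSurjection ∧
          Nonempty (𝒳.interior ≅ f.adj.toComonad) := by
  obtain ⟨⟨L, α, _, _⟩, _, ⟨i⟩⟩ := he
  obtain ⟨_, _⟩ := isLeftAdjoint_of_isLeftKanExtension_yoneda L α
  let adj := Adjunction.ofIsLeftAdjoint L
  obtain ⟨_, ⟨j⟩⟩ := exists_toComonad_iso_densityComonad yoneda adj (asIso α)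
  obtain ⟨J, f, hf, ⟨k⟩⟩ := exists_surjection_of_adjunction adj
  exact ⟨Sheaf J (Type u), inferInstance, f, ⟨B, inferInstance, J, ⟨.refl⟩⟩, hf,
    ⟨i ≪≫ j.symm ≪≫ k⟩⟩

end GenIonad

theorem mainTheorem9 {X : Type w} [Category.{u} X] (𝒳 : GeneralizedIonad X) :
    List.TFAE [
      IsGrothendieckTopos.{u} 𝒳.Opens,
      ∃ (G : Type (u + 1)) (_ : Category.{u} G) (f : GeometricMorphism (SmallCopresheaf X) G),
        IsGrothendieckTopos.{u} G ∧ f.IsSurjection ∧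
          Nonempty (𝒳.interior ≅ f.adj.toComonad),
      ∃ (G : Type (u + 1)) (_ : Category.{u} G) (f : GeometricMorphism (SmallCopresheaf X) G)
        (B : Type u) (_ : SmallCategory B) (e : B ⥤ G),
        IsGrothendieckTopos.{u} G ∧ f.IsSurjection ∧ IsFlat e ∧
          𝒳.IsGeneratedBy (e ⋙ f.inverseImage)] := by
  have := 𝒳.preCocomplete.hasFiniteLimits
  tfae_have 1 → 2 := exists_surjection_of_opens 𝒳
  tfae_have 2 → 1 := by
    rintro ⟨G, _, f, hG, hf, ⟨i⟩⟩
    exact opens_isGrothendieckTopos_of_surjection 𝒳 f hG hf i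
  tfae_have 2 → 3 := by
    rintro ⟨G, _, f, hG, hf, ⟨i⟩⟩
    obtain ⟨B, _, e, he, h⟩ := exists_flat_of_surjection 𝒳 f hG i
    exact ⟨G, _, f, B, _, e, hG, hf, he, h⟩
  tfae_have 3 → 2 := by
    rintro ⟨G, _, f, B, _, e, hG, hf, he, h⟩
    exact exists_surjection_of_isGeneratedBy 𝒳 h
  tfae_finish
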